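/- Let $R$ be an associative ring with $1$. A left denominator set of $R$ is a multiplicative submonoid $S\subseteq R$ ($1\in S$, $0\notin S$) such that $Sr\cap Rs\neq\emptyset$ for all $r\in R$, $s\in S$, and such that $rs=0$ with $r\in R$, $s\in S$ implies $tr=0$ for some $t\in S$. Put $\operatorname{ass}(S)=\{r\in R \mid sr=0 \text{ for some } s\in S\}$, an ideal of $R$, and let $S^{-1}R$ be the left localization of $R$ at $S$. Let $T_l(R)$ be the largest left denominator set of $R$ contained in the intersection of all maximal (with respect to inclusion) left denominator sets of $R$; put $Q_l^s(R)=T_l(R)^{-1}R$ and $\mathfrak{l}^s_R=\operatorname{ass}(T_l(R))$. Let $S_{l,0}(R)$ be the largest left denominator set $S$ of $R$ with $\operatorname{ass}(S)=0$, and $Q_l(R)=S_{l,0}(R)^{-1}R$. Let $\mathcal{C}_R$ be the set of regular elements (non-zero-divisors on both sides) of $R$, and $Q_{l,cl}(R)=\mathcal{C}_R^{-1}R$, which exists if and only if $\mathcal{C}_R$ satisfies the left Ore condition. A ring is left Goldie if it contains no infinite direct sum of nonzero left ideals and satisfies the ascending chain condition on left annihilators. **Theorem.** Let $R$ be a ring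 and $\pi:R\to R/\mathfrak{l}^s_R$ the canonical map. The following statements are equivalent. 1. $Q_l^s(R)$ is a semisimple ring. 2. $R/\mathfrak{l}^s_R$ is a semiprime left Goldie ring. 3. $Q_l(R/\mathfrak{l}^s_R)$ is a semisimple ring. 4. $Q_{l,cl}(R/\mathfrak{l}^s_R)$ exists and is a semisimple ring. If one of these equivalent conditions holds, then $Q_{l,cl}(R/\mathfrak{l}^s_R)$ exists, $$Q_l^s(R)\simeq Q_l(R/\mathfrak{l}^s_R)\simeq Q_{l,cl}(R/\mathfrak{l}^s_R)$$ by ring isomorphisms compatible with the canonical homomorphisms from $R$ and from $R/\mathfrak{l}^s_R$ respectively, $T_l(R)=\pi^{-1}(\mathcal{C}_{R/\mathfrak{l}^s_R})$ and $T_l(R/\mathfrak{l}^s_R)=\mathcal{C}_{R/\mathfrak{l}^s_R}$. -/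

import Mathlib

namespace LeftQuot

open OreLocalization

/-! ## Left Ore sets and left denominator sets

A multiplicative subset containing `1` is a `Submonoid`; that it does not contain `0` is the field
`zero_notMem` of `IsLeftDenominatorSet`. -/

/-- The left Ore condition: `S r ∩ R s ≠ ∅` for all `r ∈ R` and `s ∈ S`. -/
def LeftOreCondition {R : Type*} [Ring R] (S : Submonoid R) : Prop :=
  ∀ r : R, ∀ s ∈ S, ∃ t ∈ S, ∃ q : R, t * r = q * s

/-- Left reversibility: if `r s = 0` with `s ∈ S`, then `t r = 0` for some `t ∈ S`. -/
def LeftReversible {R : Type*} [Ring R] (S : Submonoid R) : Prop :=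
  ∀ r : R, ∀ s ∈ S, r * s = 0 → ∃ t ∈ S, t * r = 0

/-- `S ∈ Den_l(R)`: `S` is a left denominator set of `R`. -/
structure IsLeftDenominatorSet {R : Type*} [Ring R] (S : Submonoid R) : Prop where
  zero_notMem : (0 : R) ∉ S
  ore : LeftOreCondition S
  reversible : LeftReversible S

/-- `ass(S) = {r ∈ R | s r = 0 for some s ∈ S}`, as a set. -/
def assSet {R : Type*} [Ring R] (S : Submonoid R) : Set R :=
  {r : R | ∃ s ∈ S, s * r = 0}

/-- `ass(S)` as an ideal of `R`, for `S` satisfying the left Ore condition. -/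
def ass {R : Type*} [Ring R] (S : Submonoid R) (hS : LeftOreCondition S) : Ideal R where
  carrier := assSet S
  zero_mem' := ⟨1, S.one_mem, by simp⟩
  add_mem' := by
    rintro a b ⟨s, hs, hsa⟩ ⟨t, ht, htb⟩
    obtain ⟨u, hu, q, huq⟩ := hS s t ht
    refine ⟨u * s, S.mul_mem hu hs, ?_⟩
    rw [mul_add, mul_assoc, hsa, mul_zero, zero_add, huq, mul_assoc, htb, mul_zero]
  smul_mem' := by
    rintro c a ⟨s, hs, hsa⟩
    obtain ⟨u, hu, q, huq⟩ := hS c s hs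
    refine ⟨u, hu, ?_⟩
    rw [smul_eq_mul, ← mul_assoc, huq, mul_assoc, hsa, mul_zero]

instance ass_isTwoSided {R : Type*} [Ring R] (S : Submonoid R) (hS : LeftOreCondition S) :
    (ass S hS).IsTwoSided where
  mul_mem_of_left := by
    rintro a b ⟨s, hs, hsa⟩
    exact ⟨s, hs, by rw [← mul_assoc, hsa, zero_mul]⟩

/-- The data needed by Mathlib's `OreLocalization` (localization at a left Ore set), which does not
depend on the choices made here. -/
@[reducible] noncomputable def oreSet {R : Type*} [Ring R] (S : Submonoid R)
    (hO : LeftOreCondition S) (hR : LeftReversible S) : OreSet S where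
  ore_right_cancel r₁ r₂ s h := by
    obtain ⟨t, ht, h0⟩ := hR (r₁ - r₂) s s.2 (by rw [sub_mul, h, sub_self])
    exact ⟨⟨t, ht⟩, by rwa [mul_sub, sub_eq_zero] at h0⟩
  oreNum r s := (hO r s s.2).choose_spec.2.choose
  oreDenom r s := ⟨(hO r s s.2).choose, (hO r s s.2).choose_spec.1⟩
  ore_eq r s := (hO r s s.2).choose_spec.2.choose_spec

theorem leftOreCondition_sSup {R : Type*} [Ring R] {C : Set (Submonoid R)}
    (hC : ∀ S ∈ C, LeftOreCondition S) : LeftOreCondition (sSup C) := by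
  intro r s hs
  rw [sSup_eq_iSup', Submonoid.iSup_eq_closure] at hs
  induction hs using Submonoid.closure_induction generalizing r with
  | mem x hx =>
    obtain ⟨⟨S, hS⟩, hxS⟩ := Set.mem_iUnion.1 hx
    obtain ⟨t, ht, q, h⟩ := hC S hS r x hxS
    exact ⟨t, le_sSup (a := S) hS ht, q, h⟩
  | one => exact ⟨1, one_mem _, r, by simp⟩
  | mul x y _ _ ihx ihy =>
    obtain ⟨t, ht, q, h⟩ := ihy r
    obtain ⟨t', ht', q', h'⟩ := ihx q
    exact ⟨t' * t, mul_mem ht' ht, q', by rw [mul_assoc, h, ← mul_assoc, h', mul_assoc]⟩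

theorem leftReversible_sSup {R : Type*} [Ring R] {C : Set (Submonoid R)}
    (hC : ∀ S ∈ C, LeftReversible S) : LeftReversible (sSup C) := by
  intro r s hs
  rw [sSup_eq_iSup', Submonoid.iSup_eq_closure] at hs
  induction hs using Submonoid.closure_induction generalizing r with
  | mem x hx =>
    intro h
    obtain ⟨⟨S, hS⟩, hxS⟩ := Set.mem_iUnion.1 hx
    obtain ⟨t, ht, h⟩ := hC S hS r x hxS h
    exact ⟨t, le_sSup (a := S) hS ht, h⟩
  | one => exact fun h => ⟨1, one_mem _, by simpa using h⟩
  | mul x y _ _ ihx ihy =>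
    intro h
    obtain ⟨t, ht, h⟩ := ihy (r * x) (by rw [mul_assoc, h])
    obtain ⟨t', ht', h'⟩ := ihx (t * r) (by rw [mul_assoc, h])
    exact ⟨t' * t, mul_mem ht' ht, by rw [mul_assoc, h']⟩

/-! ## The largest strong left denominator set and the largest strong left quotient ring -/

/-- `max.Den_l(R)`: the maximal left denominator sets of `R`. -/
def maxDen (R : Type*) [Ring R] : Set (Submonoid R) :=
  {S : Submonoid R | Maximal IsLeftDenominatorSet S}

/-- The strongly left localizable elements: the intersection of all `S ∈ max.Den_l(R)`. -/
def stronglyLocalizable (R : Type*) [Ring R] : Set R :=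
  ⋂ S ∈ maxDen R, (S : Set R)

/-- The left denominator sets of `R` that consist of strongly left localizable elements. -/
def strongDen (R : Type*) [Ring R] : Set (Submonoid R) :=
  {S : Submonoid R | IsLeftDenominatorSet S ∧ (S : Set R) ⊆ stronglyLocalizable R}

/-- `T_l(R)`: the largest left denominator set of `R` contained in the set of strongly left
localizable elements (see `isGreatest_strongDenSet` and `coe_strongDenSet`). -/
def strongDenSet (R : Type*) [Ring R] : Submonoid R :=
  sSup (strongDen R)

theorem strongDenSet_ore (R : Type*) [Ring R] : LeftOreCondition (strongDenSet R) :=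
  leftOreCondition_sSup fun _ h => h.1.ore

theorem strongDenSet_reversible (R : Type*) [Ring R] : LeftReversible (strongDenSet R) :=
  leftReversible_sSup fun _ h => h.1.reversible

noncomputable instance strongDenSet_oreSet (R : Type*) [Ring R] : OreSet (strongDenSet R) :=
  oreSet _ (strongDenSet_ore R) (strongDenSet_reversible R)

/-- The strong left localization radical `𝔩^s_R = ass(T_l(R))`. -/
abbrev strongRadical (R : Type*) [Ring R] : Ideal R :=
  ass (strongDenSet R) (strongDenSet_ore R)

/-- `Q_l^s(R) = T_l(R)⁻¹ R`, the largest strong left quotient ring of `R`. -/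
abbrev StrongLeftQuotientRing (R : Type*) [Ring R] : Type _ :=
  OreLocalization (strongDenSet R) R

/-! ## The largest left quotient ring -/

/-- `Den_l(R, 0)`: the left denominator sets `S` of `R` with `ass(S) = 0`. -/
def regularDen (R : Type*) [Ring R] : Set (Submonoid R) :=
  {S : Submonoid R | IsLeftDenominatorSet S ∧ assSet S = {0}}

/-- `S_{l,0}(R)`: the largest element of `Den_l(R, 0)` (see `isGreatest_regularDenSet`). -/
def regularDenSet (R : Type*) [Ring R] : Submonoid R :=
  sSup (regularDen R)

theorem regularDenSet_ore (R : Type*) [Ring R] : LeftOreCondition (regularDenSet R) :=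
  leftOreCondition_sSup fun _ h => h.1.ore

theorem regularDenSet_reversible (R : Type*) [Ring R] : LeftReversible (regularDenSet R) :=
  leftReversible_sSup fun _ h => h.1.reversible

noncomputable instance regularDenSet_oreSet (R : Type*) [Ring R] : OreSet (regularDenSet R) :=
  oreSet _ (regularDenSet_ore R) (regularDenSet_reversible R)

/-- `Q_l(R) = S_{l,0}(R)⁻¹ R`, the largest left quotient ring of `R`. -/
abbrev LargestLeftQuotientRing (R : Type*) [Ring R] : Type _ :=
  OreLocalization (regularDenSet R) R

/-! ## The classical left quotient ring -/

/-- The classical left quotient ring of `R` exists, i.e. the set of regular elements (Mathlib's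
`nonZeroDivisors`, which is two-sided) is a left Ore set. -/
def HasClassicalLeftQuotientRing (R : Type*) [Ring R] : Prop :=
  LeftOreCondition (nonZeroDivisors R)

theorem nonZeroDivisors_leftReversible (R : Type*) [Ring R] :
    LeftReversible (nonZeroDivisors R) :=
  fun r _ hs h => ⟨1, one_mem _, by rw [one_mul]; exact hs.2 r h⟩

/-- The localization data for the regular elements, when they form a left Ore set. -/
@[reducible] noncomputable def classicalOreSet (R : Type*) [Ring R]
    (h : HasClassicalLeftQuotientRing R) : OreSet (nonZeroDivisors R) :=
  oreSet _ h (nonZeroDivisors_leftReversible R)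

/-- `Q_{l,cl}(R)`, the localization of `R` at its set of regular elements, when it exists. -/
abbrev ClassicalLeftQuotientRing (R : Type*) [Ring R]
    (h : HasClassicalLeftQuotientRing R) : Type _ :=
  @OreLocalization R _ (nonZeroDivisors R) (classicalOreSet R h) R _

/-! ## Canonical homomorphisms `r ↦ r / 1` -/

/-- The canonical homomorphism `R → Q_l^s(R)`. -/
noncomputable abbrev toStrong (R : Type*) [Ring R] : R →+* StrongLeftQuotientRing R :=
  numeratorRingHom

/-- The canonical homomorphism `R → Q_l(R)`. -/
noncomputable abbrev toLargest (R : Type*) [Ring R] : R →+* LargestLeftQuotientRing R :=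
  numeratorRingHom

/-- The canonical homomorphism `R → Q_{l,cl}(R)`. -/
noncomputable abbrev toClassical (R : Type*) [Ring R] (h : HasClassicalLeftQuotientRing R) :
    R →+* ClassicalLeftQuotientRing R h :=
  letI := classicalOreSet R h
  numeratorRingHom

/-! ## Semiprime left Goldie rings -/

/-- `R` is semiprime: `a R a = 0` implies `a = 0`. -/
def IsSemiprimeRing (R : Type*) [Ring R] : Prop :=
  ∀ a : R, (∀ r : R, a * r * a = 0) → a = 0

/-- The left annihilator `{r ∈ R | r x = 0 for all x ∈ X}` of a subset `X` of `R`. -/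
def leftAnnihilator {R : Type*} [Ring R] (X : Set R) : Ideal R where
  carrier := {r : R | ∀ x ∈ X, r * x = 0}
  zero_mem' := fun x _ => zero_mul x
  add_mem' := fun ha hb x hx => by rw [add_mul, ha x hx, hb x hx, add_zero]
  smul_mem' := fun c a ha x hx => by rw [smul_eq_mul, mul_assoc, ha x hx, mul_zero]

/-- `R` is left Goldie: no infinite direct sum of nonzero left ideals (`Ideal R` is the type of
left ideals) and the ascending chain condition on left annihilators. -/
structure IsLeftGoldieRing (R : Type*) [Ring R] : Prop where
  no_infinite_direct_sum : ¬ ∃ I : ℕ → Ideal R, iSupIndep I ∧ ∀ n, I n ≠ ⊥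
  acc_leftAnnihilators : ∀ X : ℕ → Set R, Monotone (fun n => leftAnnihilator (X n)) →
    ∃ n, ∀ m, n ≤ m → leftAnnihilator (X m) = leftAnnihilator (X n)

/-! ## `T_l(R)` and `S_{l,0}(R)` are the largest elements that they are meant to be -/

theorem exists_maxDen (R : Type*) [Ring R] [Nontrivial R] : (maxDen R).Nonempty := by
  have hbot : IsLeftDenominatorSet (⊥ : Submonoid R) := by
    refine ⟨by simp [Submonoid.mem_bot], fun r s hs => ?_, fun r s hs h => ?_⟩
    · rw [Submonoid.mem_bot] at hs
      exact ⟨1, one_mem _, r, by simp [hs]⟩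
    · rw [Submonoid.mem_bot] at hs
      exact ⟨1, one_mem _, by simpa [hs] using h⟩
  obtain ⟨M, -, hM⟩ := zorn_le_nonempty₀ {S : Submonoid R | IsLeftDenominatorSet S}
    (fun c hc hch S hS => by
      refine ⟨sSup c, ⟨?_, leftOreCondition_sSup fun S h => (hc h).ore,
        leftReversible_sSup fun S h => (hc h).reversible⟩, fun z hz => le_sSup hz⟩
      rw [Submonoid.mem_sSup_of_directedOn ⟨S, hS⟩ hch.directedOn]
      rintro ⟨S, hS, h0⟩
      exact (hc hS).zero_notMem h0) ⊥ hbot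
  exact ⟨M, hM⟩

theorem strongDen_le {R : Type*} [Ring R] {S M : Submonoid R} (hS : S ∈ strongDen R)
    (hM : M ∈ maxDen R) : S ≤ M :=
  fun _ hx => Set.mem_iInter₂.1 (hS.2 hx) M hM

theorem isGreatest_strongDenSet (R : Type*) [Ring R] [Nontrivial R] :
    IsGreatest (strongDen R) (strongDenSet R) := by
  have hle : ∀ M ∈ maxDen R, strongDenSet R ≤ M := fun M hM =>
    sSup_le fun S hS => strongDen_le hS hM
  refine ⟨⟨⟨?_, strongDenSet_ore R, strongDenSet_reversible R⟩, ?_⟩, fun S hS => le_sSup hS⟩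
  · obtain ⟨M, hM⟩ := exists_maxDen R
    exact fun h => hM.1.zero_notMem (hle M hM h)
  · exact fun x hx => Set.mem_iInter₂.2 fun M hM => hle M hM hx

theorem coe_strongDenSet (R : Type*) [Ring R] [Nontrivial R] :
    (strongDenSet R : Set R) = ⋃ S ∈ strongDen R, (S : Set R) :=
  Set.Subset.antisymm
    (fun _ hx => Set.mem_iUnion₂.2 ⟨_, (isGreatest_strongDenSet R).1, hx⟩)
    (Set.iUnion₂_subset fun _ hS => (isGreatest_strongDenSet R).2 hS)

theorem isGreatest_regularDenSet (R : Type*) [Ring R] [Nontrivial R] :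
    IsGreatest (regularDen R) (regularDenSet R) := by
  have hle : regularDenSet R ≤ nonZeroDivisorsLeft R := sSup_le fun S hS s hs r hr => by
    have : r ∈ assSet S := ⟨s, hs, hr⟩
    rw [hS.2] at this
    exact this
  refine ⟨⟨⟨fun h => ?_, regularDenSet_ore R, regularDenSet_reversible R⟩, ?_⟩,
    fun S hS => le_sSup hS⟩
  · exact one_ne_zero (hle h (1 : R) (zero_mul 1))
  · ext r
    refine ⟨fun ⟨s, hs, h⟩ => hle hs r h, fun h => ?_⟩
    rw [Set.mem_singleton_iff.1 h]
    exact ⟨1, one_mem _, mul_zero 1⟩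

end LeftQuot

/-!
Write `A = R/𝔩^s_R`. Whether or not the quotient rings are semisimple, `Q_l^s(R) ≃ Q_l(A)` over `R`,
`T_l(R)` is the preimage of `S_{l,0}(A)`, and `T_l(A) = S_{l,0}(A)`. Indeed the image of `T_l(R)` in
`A` is a left Ore set of regular elements, and such a set lies in every maximal left denominator set
(`le_of_mem_maxDen`). Left denominator sets that contain `T_l(R)`, respectively its image, can be
transported between `R` and `A` in both directions, so every maximal left denominator set of `R` is
the preimage of a maximal one of `A`. Hence the preimage of `T_l(A)` lies in `T_l(R)`
(`comap_strongDenSet`), which forces `T_l(A)` to consist of regular elements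
(`strongDenSet_quotient_eq_regularDenSet`). Moreover `S_{l,0}(A)` is the set of regular elements as
soon as the latter is a left Ore set (`regularDenSet_eq_nonZeroDivisors`).

What remains is Goldie's theorem for `A`. If the localization of `A` at a left Ore set of regular
elements is semisimple, then `A` is semiprime left Goldie (`isSemiprimeRing_of_isLeftLocalization`,
`isLeftGoldieRing_of_isLeftLocalization`). Conversely, in a semiprime left Goldie ring every
essential left ideal contains a regular element (`IsLeftGoldieRing.exists_mem_nonZeroDivisors`).
This gives the left Ore condition for the regular elements, and complements of the left ideals of
the classical left quotient ring. The finiteness of the uniform dimension is used through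
descending sequences of left ideals only (`IsLeftGoldieRing.exists_eq_bot_of_antitone`).
-/

namespace LeftQuot

/-! ### Recognizing left localizations -/

/-- `f : R →+* Q` makes `Q` a left localization of `R` at `S`: the elements of `S` become units,
every element of `Q` has the form `f s⁻¹ * f r` with `s ∈ S`, and the kernel of `f` is not larger
than `ass S` (the first condition gives the other inclusion). -/
structure IsLeftLocalization {R Q : Type*} [Ring R] [Ring Q] (S : Submonoid R) (f : R →+* Q) :
    Prop where
  isUnit : ∀ s ∈ S, IsUnit (f s)
  exists_mul_eq : ∀ q : Q, ∃ s ∈ S, ∃ r : R, f s * q = f r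
  mem_assSet : ∀ r : R, f r = 0 → r ∈ assSet S

theorem isLeftLocalization_numeratorRingHom {R : Type*} [Ring R] (S : Submonoid R)
    [OreLocalization.OreSet S] :
    IsLeftLocalization S
      (OreLocalization.numeratorRingHom : R →+* OreLocalization S R) where
  isUnit s hs := OreLocalization.numerator_isUnit (⟨s, hs⟩ : S)
  exists_mul_eq q := by
    induction q with | _ r s
    exact ⟨s, s.2, r, OreLocalization.mul_cancel⟩
  mem_assSet r h := by
    have h' : OreLocalization.oreDiv r (1 : S) = OreLocalization.oreDiv 0 (1 : S) := by
      rw [OreLocalization.zero_oreDiv]; exact h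
    obtain ⟨u, v, h1, h2⟩ := OreLocalization.oreDiv_eq_iff.1 h'
    -- `u * 0 = v * r` and `u = v`
    simp only [Submonoid.smul_def, smul_eq_mul, mul_zero, OneMemClass.coe_one, mul_one] at h1 h2
    exact ⟨u, u.2, by rw [h2, ← h1]⟩

/-- A left localization is isomorphic, under `R`, to Mathlib's Ore localization. -/
theorem IsLeftLocalization.exists_ringEquiv {R Q : Type*} [Ring R] [Ring Q] {S : Submonoid R}
    [OreLocalization.OreSet S] {f : R →+* Q} (hf : IsLeftLocalization S f) :
    ∃ e : OreLocalization S R ≃+* Q, ∀ r : R, e (OreLocalization.numeratorRingHom r) = f r := by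
  let fS : S →* Qˣ := IsUnit.liftRight ((f : R →* Q).comp S.subtype) fun s => hf.isUnit s s.2
  have hfS : ∀ s : S, f s = fS s := fun s => rfl
  let φ := OreLocalization.universalHom f fS hfS
  have hφ : ∀ r : R, φ (OreLocalization.numeratorRingHom r) = f r := fun r =>
    OreLocalization.universalHom_commutes f fS hfS
  have hloc := isLeftLocalization_numeratorRingHom S
  refine ⟨RingEquiv.ofBijective φ ⟨?_, fun q => ?_⟩, hφ⟩
  · refine (injective_iff_map_eq_zero φ).2 fun x hx => ?_
    obtain ⟨s, hs, r, h⟩ := hloc.exists_mul_eq x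
    have h0 : f r = 0 := by rw [← hφ r, ← h, map_mul, hx, mul_zero]
    obtain ⟨t, ht, htr⟩ := hf.mem_assSet r h0
    have hr : (OreLocalization.numeratorRingHom r : OreLocalization S R) = 0 := by
      rw [← (hloc.isUnit t ht).mul_right_eq_zero, ← map_mul, htr, map_zero]
    rw [← (hloc.isUnit s hs).mul_right_eq_zero, h, hr]
  · obtain ⟨s, hs, r, h⟩ := hf.exists_mul_eq q
    obtain ⟨u, hu⟩ := hloc.isUnit s hs
    refine ⟨↑u⁻¹ * (OreLocalization.numeratorRingHom r : OreLocalization S R),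
      (hf.isUnit s hs).mul_left_cancel ?_⟩
    rw [h, ← hφ s, ← map_mul, ← hu, Units.mul_inv_cancel_left, hφ]

/-! ### Left denominator sets modulo `ass(T)` -/

/-- A left Ore set of elements that can be cancelled on the right lies in every maximal left
denominator set `M`: the submonoid generated by both satisfies the conditions of a left denominator
set, and it does not contain `0` because `r x = 0` implies `r ∈ ass M` for each of its
elements `x`. -/
theorem le_of_mem_maxDen {R : Type*} [Ring R] {S M : Submonoid R} (hO : LeftOreCondition S)
    (hS : S ≤ nonZeroDivisorsRight R) (hM : M ∈ maxDen R) : S ≤ M := by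
  have key : ∀ x ∈ S ⊔ M, ∀ r : R, r * x = 0 → r ∈ assSet M := by
    intro x hx
    rw [Submonoid.sup_eq_closure] at hx
    induction hx using Submonoid.closure_induction with
    | mem x hx =>
      intro r h
      rcases hx with hx | hx
      · exact ⟨1, one_mem _, by rw [hS hx r h, mul_zero]⟩
      · exact hM.1.reversible r x hx h
    | one => exact fun r h => ⟨1, one_mem _, by simpa using h⟩
    | mul x y _ _ ihx ihy =>
      intro r h
      obtain ⟨m, hm, h⟩ := ihy (r * x) (by rw [mul_assoc, h])
      obtain ⟨m', hm', h⟩ := ihx (m * r) (by rw [mul_assoc, h])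
      exact ⟨m' * m, mul_mem hm' hm, by rw [mul_assoc, h]⟩
  have hden : IsLeftDenominatorSet (S ⊔ M) := by
    refine ⟨fun h0 => ?_, ?_, ?_⟩
    · obtain ⟨m, hm, h⟩ := key 0 h0 1 (mul_zero 1)
      rw [mul_one] at h
      exact hM.1.zero_notMem (h ▸ hm)
    · rw [← sSup_pair]
      rintro r s hs
      refine leftOreCondition_sSup (C := {S, M}) ?_ r s hs
      rintro _ (rfl | rfl)
      exacts [hO, hM.1.ore]
    · intro r s hs h
      obtain ⟨m, hm, h⟩ := key s hs r h
      exact ⟨m, le_sup_right (a := S) hm, h⟩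
  exact le_sup_left.trans (hM.2 hden le_sup_right)

theorem regularDenSet_le_nonZeroDivisors (R : Type*) [Ring R] :
    regularDenSet R ≤ nonZeroDivisors R := by
  refine sSup_le fun S hS s hs => ?_
  have hmem : ∀ r, r ∈ assSet S → r = 0 := fun r hr => by rwa [hS.2] at hr
  exact ⟨fun r h => hmem r ⟨s, hs, h⟩, fun r h => hmem r (hS.1.reversible r s hs h)⟩

theorem le_regularDenSet {R : Type*} [Ring R] {S : Submonoid R} (hO : LeftOreCondition S)
    (hS : S ≤ nonZeroDivisors R) : S ≤ regularDenSet R := by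
  cases subsingleton_or_nontrivial R
  · exact fun x _ => Subsingleton.elim 1 x ▸ one_mem _
  · refine le_sSup ⟨⟨fun h => ?_, hO, fun r s hs h => ⟨1, one_mem _, ?_⟩⟩, ?_⟩
    · exact one_ne_zero ((hS h).1 1 (zero_mul 1))
    · rw [(hS hs).2 r h, mul_zero]
    · ext r
      refine ⟨fun ⟨s, hs, h⟩ => (hS hs).1 r h, ?_⟩
      rintro rfl
      exact ⟨1, one_mem _, mul_zero 1⟩

/-- If the regular elements form a left Ore set, they are the largest left denominator set `S` with
`ass S = 0`. -/
theorem regularDenSet_eq_nonZeroDivisors {R : Type*} [Ring R]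
    (h : HasClassicalLeftQuotientRing R) : regularDenSet R = nonZeroDivisors R :=
  le_antisymm (regularDenSet_le_nonZeroDivisors R) (le_regularDenSet h le_rfl)

theorem regularDenSet_le_strongDenSet (R : Type*) [Ring R] :
    regularDenSet R ≤ strongDenSet R := by
  cases subsingleton_or_nontrivial R
  · exact fun x _ => Subsingleton.elim 1 x ▸ one_mem _
  · refine le_sSup ⟨(isGreatest_regularDenSet R).1.1, fun x hx => Set.mem_iInter₂.2 fun M hM => ?_⟩
    exact le_of_mem_maxDen (regularDenSet_ore R)
      ((regularDenSet_le_nonZeroDivisors R).trans inf_le_right) hM hx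

theorem strongDenSet_le_of_mem_maxDen {R : Type*} [Ring R] {M : Submonoid R} (hM : M ∈ maxDen R) :
    strongDenSet R ≤ M :=
  sSup_le fun _ hS => strongDen_le hS hM

theorem exists_le_mem_maxDen {R : Type*} [Ring R] {S : Submonoid R} (hS : IsLeftDenominatorSet S) :
    ∃ M ∈ maxDen R, S ≤ M := by
  obtain ⟨M, hSM, hM⟩ := zorn_le_nonempty₀ {S : Submonoid R | IsLeftDenominatorSet S}
    (fun c hc hch S hS => by
      refine ⟨sSup c, ⟨?_, leftOreCondition_sSup fun S h => (hc h).ore,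
        leftReversible_sSup fun S h => (hc h).reversible⟩, fun z hz => le_sSup hz⟩
      rw [Submonoid.mem_sSup_of_directedOn ⟨S, hS⟩ hch.directedOn]
      rintro ⟨S, hS, h0⟩
      exact (hc hS).zero_notMem h0) S hS
  exact ⟨M, hM, hSM⟩

theorem LeftOreCondition.map {R A : Type*} [Ring R] [Ring A] {S : Submonoid R}
    (hS : LeftOreCondition S) {f : R →+* A} (hf : Function.Surjective f) :
    LeftOreCondition (S.map f) := by
  rintro r _ ⟨s, hs, rfl⟩
  obtain ⟨r, rfl⟩ := hf r
  obtain ⟨t, ht, q, h⟩ := hS r s hs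
  exact ⟨f t, ⟨t, ht, rfl⟩, f q, by rw [← map_mul, h, map_mul]⟩

section Quotient

variable {R : Type*} [Ring R] {T : Submonoid R} (hT : LeftOreCondition T)

theorem mk_ass_eq_zero_iff {r : R} :
    Ideal.Quotient.mk (ass T hT) r = 0 ↔ ∃ t ∈ T, t * r = 0 :=
  Ideal.Quotient.eq_zero_iff_mem

theorem IsLeftDenominatorSet.map_mk_ass {M : Submonoid R} (hM : IsLeftDenominatorSet M)
    (hTM : T ≤ M) : IsLeftDenominatorSet (M.map (Ideal.Quotient.mk (ass T hT))) where
  zero_notMem := by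
    rintro ⟨m, hm, h⟩
    obtain ⟨t, ht, h⟩ := (mk_ass_eq_zero_iff hT).1 h
    exact hM.zero_notMem (h ▸ mul_mem (hTM ht) hm)
  ore := hM.ore.map Ideal.Quotient.mk_surjective
  reversible := by
    rintro r _ ⟨m, hm, rfl⟩ h
    obtain ⟨r, rfl⟩ := Ideal.Quotient.mk_surjective r
    rw [← map_mul, mk_ass_eq_zero_iff] at h
    obtain ⟨t, ht, h⟩ := h
    obtain ⟨m', hm', h⟩ := hM.reversible (t * r) m hm (by rw [mul_assoc, h])
    exact ⟨_, ⟨m' * t, mul_mem hm' (hTM ht), rfl⟩, by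
      rw [← map_mul, mul_assoc, h, map_zero]⟩

theorem IsLeftDenominatorSet.comap_mk_ass {M : Submonoid (R ⧸ ass T hT)}
    (hM : IsLeftDenominatorSet M) (hTM : T ≤ M.comap (Ideal.Quotient.mk (ass T hT))) :
    IsLeftDenominatorSet (M.comap (Ideal.Quotient.mk (ass T hT))) where
  zero_notMem h := hM.zero_notMem (by simpa using h)
  ore := by
    intro r s hs
    obtain ⟨t, ht, q, h⟩ := hM.ore (Ideal.Quotient.mk _ r) _ hs
    obtain ⟨t, rfl⟩ := Ideal.Quotient.mk_surjective t
    obtain ⟨q, rfl⟩ := Ideal.Quotient.mk_surjective q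
    rw [← map_mul, ← map_mul, ← sub_eq_zero, ← map_sub,
      mk_ass_eq_zero_iff] at h
    obtain ⟨u, hu, h⟩ := h
    exact ⟨u * t, mul_mem (hTM hu) ht, u * q, by
      rwa [mul_sub, sub_eq_zero, ← mul_assoc, ← mul_assoc] at h⟩
  reversible := by
    intro r s hs h
    obtain ⟨t, ht, h⟩ := hM.reversible (Ideal.Quotient.mk _ r) _ hs (by
      rw [← map_mul, h, map_zero])
    obtain ⟨t, rfl⟩ := Ideal.Quotient.mk_surjective t
    rw [← map_mul, mk_ass_eq_zero_iff] at h
    obtain ⟨u, hu, h⟩ := h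
    exact ⟨u * t, mul_mem (hTM hu) ht, by rw [mul_assoc, h]⟩

theorem map_mk_ass_le_nonZeroDivisors (hR : LeftReversible T) :
    T.map (Ideal.Quotient.mk (ass T hT)) ≤ nonZeroDivisors (R ⧸ ass T hT) := by
  rintro _ ⟨s, hs, rfl⟩
  refine ⟨fun r h => ?_, fun r h => ?_⟩ <;>
  · obtain ⟨r, rfl⟩ := Ideal.Quotient.mk_surjective r
    rw [← map_mul, mk_ass_eq_zero_iff] at h
    obtain ⟨t, ht, h⟩ := h
    rw [mk_ass_eq_zero_iff]
    first
    | exact ⟨t * s, mul_mem ht hs, by rw [mul_assoc, h]⟩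
    | obtain ⟨u, hu, h⟩ := hR (t * r) s hs (by rw [mul_assoc, h])
      exact ⟨u * t, mul_mem hu ht, by rw [mul_assoc, h]⟩

end Quotient

/-! ### `T_l(R)` and `S_{l,0}(R/𝔩^s_R)` -/

theorem map_strongDenSet_le_regularDenSet (R : Type*) [Ring R] :
    (strongDenSet R).map (Ideal.Quotient.mk (strongRadical R)) ≤
      regularDenSet (R ⧸ strongRadical R) :=
  le_regularDenSet ((strongDenSet_ore R).map Ideal.Quotient.mk_surjective)
    (map_mk_ass_le_nonZeroDivisors _ (strongDenSet_reversible R))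

/-- The maximal left denominator sets of `R` are preimages of maximal left denominator sets of
`R/𝔩^s_R`, so the preimage of `T_l(R/𝔩^s_R)` consists of strongly left localizable elements. -/
theorem comap_strongDenSet (R : Type*) [Ring R] :
    (strongDenSet (R ⧸ strongRadical R)).comap (Ideal.Quotient.mk (strongRadical R)) =
      strongDenSet R := by
  cases subsingleton_or_nontrivial R
  · ext x
    simp [Subsingleton.elim x 1, one_mem]
  have hT := (isGreatest_strongDenSet R).1.1
  have hne : Nontrivial (R ⧸ strongRadical R) := by
    refine Ideal.Quotient.nontrivial_iff.2 fun h => ?_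
    obtain ⟨t, ht, h⟩ : (1 : R) ∈ strongRadical R := h ▸ Submodule.mem_top
    exact hT.zero_notMem (by simpa [← h] using ht)
  have hle : strongDenSet R ≤
      (strongDenSet (R ⧸ strongRadical R)).comap (Ideal.Quotient.mk (strongRadical R)) :=
    Submonoid.map_le_iff_le_comap.1
      ((map_strongDenSet_le_regularDenSet R).trans (regularDenSet_le_strongDenSet _))
  refine le_antisymm (le_sSup ⟨?_, fun x hx => Set.mem_iInter₂.2 fun M hM => ?_⟩) hle
  · exact (isGreatest_strongDenSet _).1.1.comap_mk_ass _ hle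
  · obtain ⟨M', hM', hMM'⟩ := exists_le_mem_maxDen
      (hM.1.map_mk_ass (strongDenSet_ore R) (strongDenSet_le_of_mem_maxDen hM))
    rw [Submonoid.map_le_iff_le_comap] at hMM'
    exact hM.2 (hM'.1.comap_mk_ass _ ((strongDenSet_le_of_mem_maxDen hM).trans hMM')) hMM'
      (strongDenSet_le_of_mem_maxDen hM' hx)

/-- Over `R/𝔩^s_R` the largest strong left denominator set consists of regular elements, hence is
the largest left denominator set with this property. -/
theorem strongDenSet_quotient_eq_regularDenSet (R : Type*) [Ring R] :
    strongDenSet (R ⧸ strongRadical R) = regularDenSet (R ⧸ strongRadical R) := by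
  refine le_antisymm (le_regularDenSet (strongDenSet_ore _) fun s hs => ?_)
    (regularDenSet_le_strongDenSet _)
  have hann : ∀ t ∈ strongDenSet (R ⧸ strongRadical R), ∀ r, t * r = 0 → r = 0 := by
    intro t ht r h
    obtain ⟨t, rfl⟩ := Ideal.Quotient.mk_surjective t
    obtain ⟨r, rfl⟩ := Ideal.Quotient.mk_surjective r
    rw [← map_mul, mk_ass_eq_zero_iff] at h
    obtain ⟨u, hu, h⟩ := h
    have ht' : t ∈ strongDenSet R := by rw [← comap_strongDenSet]; exact ht
    exact (mk_ass_eq_zero_iff _).2 ⟨u * t, mul_mem hu ht', by rw [mul_assoc, h]⟩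
  refine ⟨hann s hs, fun r h => ?_⟩
  obtain ⟨t, ht, h⟩ := strongDenSet_reversible _ r s hs h
  exact hann t ht r h

theorem strongDenSet_eq_comap_regularDenSet (R : Type*) [Ring R] :
    strongDenSet R = (regularDenSet (R ⧸ strongRadical R)).comap
      (Ideal.Quotient.mk (strongRadical R)) := by
  rw [← strongDenSet_quotient_eq_regularDenSet, comap_strongDenSet]

theorem isLeftLocalization_toLargest (R : Type*) [Ring R] :
    IsLeftLocalization (regularDenSet R) (toLargest R) :=
  isLeftLocalization_numeratorRingHom _

/-- `Q_l(R/𝔩^s_R)` is also the left localization of `R` at `T_l(R)`. -/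
theorem isLeftLocalization_toLargest_comp_mk (R : Type*) [Ring R] :
    IsLeftLocalization (strongDenSet R)
      ((toLargest (R ⧸ strongRadical R)).comp (Ideal.Quotient.mk (strongRadical R))) where
  isUnit s hs := (isLeftLocalization_toLargest _).isUnit _
    (map_strongDenSet_le_regularDenSet R ⟨s, hs, rfl⟩)
  exists_mul_eq q := by
    obtain ⟨s, hs, r, h⟩ := (isLeftLocalization_toLargest _).exists_mul_eq q
    obtain ⟨s, rfl⟩ := Ideal.Quotient.mk_surjective s
    obtain ⟨r, rfl⟩ := Ideal.Quotient.mk_surjective r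
    refine ⟨s, ?_, r, h⟩
    rw [strongDenSet_eq_comap_regularDenSet]
    exact hs
  mem_assSet r h := by
    obtain ⟨s, hs, h⟩ := (isLeftLocalization_toLargest _).mem_assSet _ h
    exact (mk_ass_eq_zero_iff _).1 ((regularDenSet_le_nonZeroDivisors _ hs).1 _ h)

theorem isLeftLocalization_toClassical {R : Type*} [Ring R] (h : HasClassicalLeftQuotientRing R) :
    IsLeftLocalization (nonZeroDivisors R) (toClassical R h) :=
  letI := classicalOreSet R h
  isLeftLocalization_numeratorRingHom _

/-! ### Left orders in semisimple rings are semiprime left Goldie -/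

section LeftOrder

variable {R Q : Type*} [Ring R] [Ring Q] {S : Submonoid R} {f : R →+* Q}

theorem IsLeftLocalization.injective (hf : IsLeftLocalization S f) (hS : S ≤ nonZeroDivisors R) :
    Function.Injective f := by
  refine (injective_iff_map_eq_zero f).2 fun r h => ?_
  obtain ⟨s, hs, h⟩ := hf.mem_assSet r h
  exact (hS hs).1 r h

theorem IsLeftLocalization.leftOreCondition (hf : IsLeftLocalization S f)
    (hS : S ≤ nonZeroDivisors R) : LeftOreCondition S := by
  intro r s hs
  obtain ⟨u, hu⟩ := hf.isUnit s hs
  obtain ⟨t, ht, q, h⟩ := hf.exists_mul_eq (f r * ↑u⁻¹)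
  refine ⟨t, ht, q, hf.injective hS ?_⟩
  rw [map_mul, map_mul, ← h, ← hu, mul_assoc, mul_assoc, Units.inv_mul, mul_one]

/-- The left ideal of `Q` generated by a left ideal `I` of `R` consists of the left fractions with
numerators in `I`. -/
theorem IsLeftLocalization.exists_mul_eq_of_mem_map (hf : IsLeftLocalization S f)
    (hO : LeftOreCondition S) {I : Ideal R} {q : Q} (hq : q ∈ I.map f) :
    ∃ s ∈ S, ∃ a ∈ I, f s * q = f a := by
  induction hq using Submodule.span_induction with
  | mem x hx =>
    obtain ⟨a, ha, rfl⟩ := hx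
    exact ⟨1, one_mem _, a, ha, by simp⟩
  | zero => exact ⟨1, one_mem _, 0, I.zero_mem, by simp⟩
  | add x y _ _ ihx ihy =>
    obtain ⟨s, hs, a, ha, hx⟩ := ihx
    obtain ⟨t, ht, b, hb, hy⟩ := ihy
    obtain ⟨u, hu, v, h⟩ := hO s t ht
    refine ⟨u * s, mul_mem hu hs, u * a + v * b,
      I.add_mem (I.mul_mem_left _ ha) (I.mul_mem_left _ hb), ?_⟩
    rw [mul_add, map_add, map_mul f u a, ← hx, map_mul f v b, ← hy, ← mul_assoc, ← mul_assoc,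
      ← map_mul, ← map_mul, h]
  | smul c x _ ih =>
    obtain ⟨s, hs, a, ha, hx⟩ := ih
    obtain ⟨u, hu⟩ := hf.isUnit s hs
    obtain ⟨t, ht, r, h⟩ := hf.exists_mul_eq (c * ↑u⁻¹)
    refine ⟨t, ht, r * a, I.mul_mem_left _ ha, ?_⟩
    rw [map_mul, ← h, ← hx, ← hu, smul_eq_mul]
    simp [mul_assoc]

theorem IsLeftLocalization.disjoint_map (hf : IsLeftLocalization S f) (hS : S ≤ nonZeroDivisors R)
    {I J : Ideal R} (h : Disjoint I J) : Disjoint (I.map f) (J.map f) := by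
  have hO := hf.leftOreCondition hS
  rw [Submodule.disjoint_def] at h ⊢
  intro q hI hJ
  obtain ⟨s, hs, a, ha, hsa⟩ := hf.exists_mul_eq_of_mem_map hO hI
  obtain ⟨t, ht, b, hb, htb⟩ := hf.exists_mul_eq_of_mem_map hO hJ
  obtain ⟨u, hu, v, huv⟩ := hO s t ht
  have hab : u * a = v * b := hf.injective hS (by
    rw [map_mul, map_mul, ← hsa, ← htb, ← mul_assoc, ← mul_assoc, ← map_mul, ← map_mul, huv])
  have h0 : u * a = 0 := h _ (I.mul_mem_left _ ha) (hab ▸ J.mul_mem_left _ hb)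
  rw [← (hf.isUnit s hs).mul_right_eq_zero, hsa, (hS hu).1 a h0, map_zero]

/-- A left ideal `J` of `Q` is determined by its intersection with `R`. -/
theorem IsLeftLocalization.eq_bot_of_comap (hf : IsLeftLocalization S f) {J : Ideal Q}
    (h : ∀ r : R, f r ∈ J → r = 0) : J = ⊥ := by
  refine (Submodule.eq_bot_iff J).2 fun q hq => ?_
  obtain ⟨s, hs, r, hr⟩ := hf.exists_mul_eq q
  have : r = 0 := h r (hr ▸ J.mul_mem_left _ hq)
  rwa [this, map_zero, (hf.isUnit s hs).mul_right_eq_zero] at hr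

/-- A left annihilator `A` of `R` is the preimage of the left ideal of `Q` generated by `A`. -/
theorem mem_leftAnnihilator_of_map_mem (hf : Function.Injective f) {X : Set R} {r : R}
    (h : f r ∈ (leftAnnihilator X).map f) : r ∈ leftAnnihilator X := by
  intro x hx
  have key : ∀ q ∈ (leftAnnihilator X).map f, q * f x = 0 := by
    intro q hq
    induction hq using Submodule.span_induction with
    | mem q hq =>
      obtain ⟨a, ha, rfl⟩ := hq
      rw [← map_mul, ha x hx, map_zero]
    | zero => exact zero_mul _
    | add p q _ _ hp hq => rw [add_mul, hp, hq, add_zero]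
    | smul c q _ hq => rw [smul_eq_mul, mul_assoc, hq, mul_zero]
  exact hf (by rw [map_mul, key _ h, map_zero])

/-- Left annihilators and direct sums of left ideals of `R` extend faithfully to `Q`. -/
theorem isLeftGoldieRing_of_isLeftLocalization (hf : IsLeftLocalization S f)
    (hS : S ≤ nonZeroDivisors R) [IsNoetherianRing Q] : IsLeftGoldieRing R where
  no_infinite_direct_sum := by
    rintro ⟨I, hI, hne⟩
    have hind : iSupIndep fun n => (I n).map f := by
      intro n
      have := hf.disjoint_map hS (hI n)
      simpa only [Ideal.map_iSup] using this
    have hne' : ∀ n, (I n).map f ≠ ⊥ := fun n h => hne n ((Submodule.eq_bot_iff _).2 fun a ha =>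
      hf.injective hS (by
        rw [map_zero]
        exact (Submodule.eq_bot_iff _).1 h _ (Ideal.mem_map_of_mem f ha)))
    have hfin := WellFoundedGT.finite_ne_bot_of_iSupIndep hind
    simp only [hne', ne_eq, not_false_eq_true, Set.ofPred_true] at hfin
    exact Set.infinite_univ hfin
  acc_leftAnnihilators X hX := by
    obtain ⟨n, hn⟩ := monotone_stabilizes_iff_noetherian.2 (inferInstance : IsNoetherianRing Q)
      ⟨fun n => (leftAnnihilator (X n)).map f, fun m n h => Ideal.map_mono (hX h)⟩
    refine ⟨n, fun m hm => le_antisymm (fun r hr => ?_) (hX hm)⟩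
    refine mem_leftAnnihilator_of_map_mem (hf.injective hS) ?_
    have := hn m hm
    change (leftAnnihilator (X n)).map f = (leftAnnihilator (X m)).map f at this
    rw [this]
    exact Ideal.mem_map_of_mem f hr

/-- If `a R a = 0`, then the right annihilator `K` of `R a R` meets every nonzero left ideal of `R`.
Hence `K` generates an essential left ideal of the semisimple ring `Q`, which is all of `Q`, so `K`
contains an element of `S` and `a = 0`. -/
theorem isSemiprimeRing_of_isLeftLocalization (hf : IsLeftLocalization S f)
    (hS : S ≤ nonZeroDivisors R) [IsSemisimpleRing Q] : IsSemiprimeRing R := by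
  intro a ha
  let K : Ideal R :=
    { carrier := {r | ∀ x, a * x * r = 0}
      zero_mem' := fun x => mul_zero _
      add_mem' := fun hb hc x => by rw [mul_add, hb x, hc x, add_zero]
      smul_mem' := fun c b hb x => by rw [smul_eq_mul, ← mul_assoc, mul_assoc a, hb] }
  obtain ⟨J, hJ⟩ := exists_isCompl (K.map f)
  have hJ0 : J = ⊥ := by
    refine hf.eq_bot_of_comap fun r hr => ?_
    have hdisj : ∀ b, f b ∈ J → b ∈ K → b = 0 := fun b hbJ hbK => hf.injective hS (by
      rw [map_zero]
      exact Submodule.disjoint_def.1 hJ.disjoint _ (Ideal.mem_map_of_mem f hbK) hbJ)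
    refine hdisj r hr fun x => hdisj _ ?_ fun y => ?_
    · rw [map_mul]
      exact J.mul_mem_left _ hr
    · rw [← mul_assoc, ← mul_assoc, ha, zero_mul, zero_mul]
  have htop : (1 : Q) ∈ K.map f := by
    have := hJ.sup_eq_top
    rw [hJ0, sup_bot_eq] at this
    exact this ▸ Submodule.mem_top
  obtain ⟨s, hs, k, hk, h⟩ := hf.exists_mul_eq_of_mem_map (hf.leftOreCondition hS) htop
  obtain rfl : s = k := hf.injective hS (by rw [← h, mul_one])
  exact (hS hs).2 a (by simpa using hk 1)

end LeftOrder

/-! ### Goldie's theorem -/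

/-- A left ideal `E` is essential if it meets every nonzero left ideal of `R`; it is enough to
consider the principal ones. -/
def IsEssentialLeftIdeal {R : Type*} [Ring R] (E : Ideal R) : Prop :=
  ∀ x : R, x ≠ 0 → ∃ r : R, r * x ∈ E ∧ r * x ≠ 0

section Goldie

variable {R : Type*} [Ring R]

theorem mem_leftAnnihilator_singleton {x r : R} : r ∈ leftAnnihilator {x} ↔ r * x = 0 :=
  ⟨fun h => h x rfl, fun h y hy => by rw [Set.mem_singleton_iff.1 hy, h]⟩

theorem leftAnnihilator_singleton_le_iff {x y : R} :
    leftAnnihilator {x} ≤ leftAnnihilator {y} ↔ ∀ r : R, r * x = 0 → r * y = 0 := by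
  simp only [SetLike.le_def, mem_leftAnnihilator_singleton]

theorem IsEssentialLeftIdeal.mono {E F : Ideal R} (hE : IsEssentialLeftIdeal E) (h : E ≤ F) :
    IsEssentialLeftIdeal F := fun x hx =>
  let ⟨r, hr, hr0⟩ := hE x hx
  ⟨r, h hr, hr0⟩

/-- The left ideal `{y | y x ∈ E}` is essential if `E` is. -/
theorem IsEssentialLeftIdeal.exists_mul_mul_mem {E : Ideal R} (hE : IsEssentialLeftIdeal E) (x : R)
    {y : R} (hy : y ≠ 0) : ∃ r : R, r * y * x ∈ E ∧ r * y ≠ 0 := by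
  by_cases h : y * x = 0
  · exact ⟨1, by rw [one_mul, h]; exact E.zero_mem, by rwa [one_mul]⟩
  · obtain ⟨r, hr, hr0⟩ := hE _ h
    rw [← mul_assoc] at hr hr0
    exact ⟨r, hr, left_ne_zero_of_mul hr0⟩

theorem IsEssentialLeftIdeal.leftAnnihilator_mul {z : R}
    (hz : IsEssentialLeftIdeal (leftAnnihilator {z})) (c : R) :
    IsEssentialLeftIdeal (leftAnnihilator {c * z}) := by
  intro y hy
  obtain ⟨r, hr, hr0⟩ := hz.exists_mul_mul_mem c hy
  rw [mem_leftAnnihilator_singleton] at hr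
  exact ⟨r, by rwa [mem_leftAnnihilator_singleton, ← mul_assoc], hr0⟩

namespace IsLeftGoldieRing

variable (hR : IsLeftGoldieRing R)
include hR

/-- Among the elements with a property `P` there is one whose left annihilator is maximal. -/
theorem exists_maximal_leftAnnihilator {P : R → Prop} (hP : ∃ a, P a) :
    ∃ a, P a ∧ ∀ b, P b → (∀ r, r * a = 0 → r * b = 0) → ∀ r, r * b = 0 → r * a = 0 := by
  obtain ⟨a₀, h₀⟩ := hP
  by_contra! h
  choose g hP hle r hrg hra using fun a : {a // P a} => h a.1 a.2
  let F : {a // P a} → {a // P a} := fun a => ⟨g a, hP a⟩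
  let u : ℕ → {a // P a} := fun n => F^[n] ⟨a₀, h₀⟩
  have hu : ∀ n, u (n + 1) = F (u n) := fun n => Function.iterate_succ_apply' F n _
  obtain ⟨n, hn⟩ := hR.acc_leftAnnihilators (fun n => {(u n : R)}) (monotone_nat_of_le_succ
    fun n => leftAnnihilator_singleton_le_iff.2 (by rw [hu]; exact hle (u n)))
  have hmem : r (u n) ∈ leftAnnihilator {(u (n + 1) : R)} := by
    rw [mem_leftAnnihilator_singleton, hu]
    exact hrg (u n)
  rw [hn (n + 1) n.le_succ, mem_leftAnnihilator_singleton] at hmem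
  exact hra (u n) hmem

/-- If `L` is a descending sequence of left ideals, left ideals `I n ≤ L n` with
`I n ⊓ L (n + 1) = ⊥` form a direct sum. -/
theorem exists_eq_bot_of_antitone {I L : ℕ → Ideal R} (hL : Antitone L) (hle : ∀ n, I n ≤ L n)
    (hd : ∀ n, Disjoint (I n) (L (n + 1))) : ∃ n, I n = ⊥ := by
  by_contra! hne
  refine hR.no_infinite_direct_sum ⟨I, ?_, hne⟩
  rw [iSupIndep_iff_finsetSum_eq_zero_imp_eq_zero]
  intro s v
  induction s using Finset.induction_on_min with
  | empty => simp
  | insert a s has ih =>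
    intro hv hsum
    rw [Finset.sum_insert fun h => lt_irrefl a (has a h)] at hsum
    have hs : ∑ i ∈ s, v i ∈ L (a + 1) := sum_mem fun i hi =>
      hL (has i hi) (hle i (hv i (Finset.mem_insert_of_mem hi)))
    have ha : v a = 0 := by
      refine Submodule.disjoint_def.1 (hd a) _ (hv a (Finset.mem_insert_self a s)) ?_
      rw [eq_neg_of_add_eq_zero_left hsum]
      exact neg_mem hs
    rw [ha, zero_add] at hsum
    intro i hi
    rcases Finset.mem_insert.1 hi with rfl | hi
    · exact ha
    · exact ih (fun i hi => hv i (Finset.mem_insert_of_mem hi)) hsum i hi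

/-- If `R s ∩ R x = 0`, then the left ideals `R x sⁿ` form a direct sum. -/
theorem isEssentialLeftIdeal_span_singleton {s : R} (hs : ∀ r, r * s = 0 → r = 0) :
    IsEssentialLeftIdeal (Ideal.span {s}) := by
  have hpow : ∀ n : ℕ, ∀ r, r * s ^ n = 0 → r = 0 := fun n =>
    pow_mem (S := nonZeroDivisorsRight R) hs n
  intro x hx
  by_contra! h
  obtain ⟨n, hn⟩ := hR.exists_eq_bot_of_antitone
    (I := fun n => Ideal.span {x * s ^ n}) (L := fun n => Ideal.span {s ^ n})
    (antitone_nat_of_succ_le fun n => (Ideal.span_singleton_le_iff_mem _).2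
      (Ideal.mem_span_singleton'.2 ⟨s, (pow_succ' s n).symm⟩))
    (fun n => (Ideal.span_singleton_le_iff_mem _).2 (Ideal.mem_span_singleton'.2 ⟨x, rfl⟩))
    (fun n => by
      refine Submodule.disjoint_def.2 fun y hy hy' => ?_
      obtain ⟨r, rfl⟩ := Ideal.mem_span_singleton'.1 hy
      obtain ⟨q, hq⟩ := Ideal.mem_span_singleton'.1 hy'
      have hrx : q * s - r * x = 0 := hpow n _ (by
        rw [sub_mul, mul_assoc, ← pow_succ', hq, mul_assoc, sub_self])
      have := h r (Ideal.mem_span_singleton'.2 ⟨q, sub_eq_zero.1 hrx⟩)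
      rw [← mul_assoc, this, zero_mul])
  exact hx (hpow n x (Ideal.span_singleton_eq_bot.1 hn))

variable (hsp : IsSemiprimeRing R)
include hsp

/-- A semiprime left Goldie ring is left nonsingular: if `a` is a nonzero element with essential and
maximal left annihilator, then `a x a = 0` for all `x`. -/
theorem eq_zero_of_isEssentialLeftIdeal {z : R}
    (hz : IsEssentialLeftIdeal (leftAnnihilator {z})) : z = 0 := by
  by_contra h
  obtain ⟨a, ⟨ha0, ha⟩, hmax⟩ := hR.exists_maximal_leftAnnihilator
    (P := fun z => z ≠ 0 ∧ IsEssentialLeftIdeal (leftAnnihilator {z})) ⟨z, h, hz⟩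
  refine ha0 (hsp a fun x => ?_)
  by_contra hx
  -- the essential left ideal of all `y` with `y x a = 0` meets `R a`
  obtain ⟨r, hr, hr0⟩ := ha.leftAnnihilator_mul x a ha0
  rw [mem_leftAnnihilator_singleton] at hr
  exact hr0 (hmax _ ⟨hx, ha.leftAnnihilator_mul (a * x)⟩
    (fun y hy => by rw [← mul_assoc, ← mul_assoc, hy, zero_mul, zero_mul]) r
    (by rw [mul_assoc a, ← mul_assoc, hr]))

/-- A semiprime left Goldie ring has no nonzero nil left ideals: if `a` is a nonzero element with
`R a` nil and with maximal left annihilator, then `ann(a (x a)ᵏ) = ann(a)` as long as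
`a (x a)ᵏ ≠ 0`, and for the last such `k` this gives `a x a = 0`. -/
theorem eq_zero_of_isNilpotent_mul {a : R} (ha : ∀ r : R, IsNilpotent (r * a)) : a = 0 := by
  by_contra h
  obtain ⟨a, ⟨ha0, ha⟩, hmax⟩ := hR.exists_maximal_leftAnnihilator
    (P := fun a => a ≠ 0 ∧ ∀ r : R, IsNilpotent (r * a)) ⟨a, h, ha⟩
  refine ha0 (hsp a fun x => ?_)
  obtain ⟨k, hk, hk'⟩ : ∃ k : ℕ, a * (x * a) ^ k ≠ 0 ∧ a * (x * a) ^ (k + 1) = 0 := by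
    by_contra! hstep
    have hne : ∀ k : ℕ, a * (x * a) ^ k ≠ 0 := fun k => by
      induction k with
      | zero => simpa using ha0
      | succ k ih => exact hstep k ih
    obtain ⟨n, hn⟩ := ha x
    exact hne n (by rw [hn, mul_zero])
  refine hmax _ ⟨hk, fun r => ?_⟩ (fun r hr => by rw [← mul_assoc, hr, zero_mul]) (a * x) ?_
  · rw [← mul_pow_mul, ← mul_assoc]
    exact ha _
  · rw [← hk', pow_succ']
    simp only [mul_assoc]

/-- A nonzero left ideal contains a nonzero element `a` with `R a ∩ ann(a) = 0`, namely a high power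
of an element that is not nilpotent. -/
theorem exists_mem_forall_mul_mul_self {L : Ideal R} (hL : L ≠ ⊥) :
    ∃ a ∈ L, a ≠ 0 ∧ ∀ r, r * a * a = 0 → r * a = 0 := by
  obtain ⟨x, hxL, hx⟩ := Submodule.exists_mem_ne_zero_of_ne_bot hL
  obtain ⟨y, hyL, hy⟩ : ∃ y ∈ L, ¬ IsNilpotent y := by
    by_contra! h
    exact hx (hR.eq_zero_of_isNilpotent_mul hsp fun r => h _ (L.mul_mem_left r hxL))
  obtain ⟨_, ⟨n, rfl⟩, hmax⟩ := hR.exists_maximal_leftAnnihilator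
    (P := fun b => ∃ n : ℕ, b = y ^ (n + 1)) ⟨y, 0, by simp⟩
  refine ⟨y ^ (n + 1), ?_, fun h => hy ⟨_, h⟩, fun r hr => ?_⟩
  · rw [pow_succ]
    exact L.mul_mem_left _ hyL
  · refine hmax (y ^ (n + 1) * y ^ (n + 1)) ⟨n + 1 + n, ?_⟩
      (fun r hr => by rw [← mul_assoc, hr, zero_mul]) r (by rw [← mul_assoc, hr])
    rw [← pow_add]
    congr 1

/-- If `s x = 0`, then the left annihilator of `x` contains the essential left ideal `R s`. -/
theorem mem_nonZeroDivisors {s : R} (hs : ∀ r, r * s = 0 → r = 0) : s ∈ nonZeroDivisors R := by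
  refine ⟨fun x hx => hR.eq_zero_of_isEssentialLeftIdeal hsp ?_, hs⟩
  refine (hR.isEssentialLeftIdeal_span_singleton hs).mono ?_
  rwa [Ideal.span_singleton_le_iff_mem, mem_leftAnnihilator_singleton]

/-- An essential left ideal `E` contains a regular element. Starting from `c = 0`, as long as
`ann(c) ≠ 0` the element `c` is replaced by `c + a`, where `a` is a nonzero element of `E ∩ ann(c)`
with `R a ∩ ann(a) = 0`. The left ideals `R a` form a direct sum, so the process stops. -/
theorem exists_mem_nonZeroDivisors {E : Ideal R} (hE : IsEssentialLeftIdeal E) :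
    ∃ c ∈ E, c ∈ nonZeroDivisors R := by
  by_contra! hreg
  let Good : R → Prop := fun c => c ∈ E ∧ ∀ r, r * c * c = 0 → r * c = 0
  have hstep : ∀ c : {c // Good c}, ∃ a ∈ E, a ≠ 0 ∧ a * c.1 = 0 ∧
      ∀ r, r * a * a = 0 → r * a = 0 := by
    rintro ⟨c, hcE, hc⟩
    have hne : leftAnnihilator {c} ⊓ E ≠ ⊥ := by
      intro hbot
      refine hreg c hcE (hR.mem_nonZeroDivisors hsp fun x hx => ?_)
      by_contra hx0
      obtain ⟨r, hr, hr0⟩ := hE x hx0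
      refine hr0 ((Submodule.eq_bot_iff _).1 hbot _ ⟨?_, hr⟩)
      exact mem_leftAnnihilator_singleton.2 (by rw [mul_assoc, hx, mul_zero])
    obtain ⟨a, ⟨hac, haE⟩, ha0, ha⟩ := hR.exists_mem_forall_mul_mul_self hsp hne
    exact ⟨a, haE, ha0, mem_leftAnnihilator_singleton.1 hac, ha⟩
  choose a haE ha0 hac ha using hstep
  -- `R c ∩ R a = 0`, since `R a ⊆ ann(c)` and `R c ∩ ann(c) = 0`
  have hsum : ∀ c : {c // Good c}, ∀ y, y * (c.1 + a c) = 0 → y * c.1 = 0 ∧ y * a c = 0 := by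
    intro c y hy
    have h1 : y * c.1 = 0 := c.2.2 y (by
      have := congrArg (· * c.1) hy
      simpa only [mul_assoc, add_mul, hac, add_zero, zero_mul] using this)
    exact ⟨h1, by rwa [mul_add, h1, zero_add] at hy⟩
  have hgood : ∀ c : {c // Good c}, Good (c.1 + a c) := by
    refine fun c => ⟨E.add_mem c.2.1 (haE c), fun r hr => ?_⟩
    obtain ⟨h1, h2⟩ := hsum c _ hr
    have hrc : r * c.1 = 0 := c.2.2 r (by
      simpa only [mul_assoc, add_mul, hac, add_zero] using h1)
    rw [mul_add, hrc, zero_add] at h2 ⊢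
    exact ha c r h2
  let F : {c // Good c} → {c // Good c} := fun c => ⟨c.1 + a c, hgood c⟩
  let u : ℕ → {c // Good c} := fun n => F^[n] ⟨0, E.zero_mem, fun r _ => mul_zero r⟩
  have hu : ∀ n, (u (n + 1)).1 = (u n).1 + a (u n) := fun n =>
    congrArg Subtype.val (Function.iterate_succ_apply' F n _)
  obtain ⟨n, hn⟩ := hR.exists_eq_bot_of_antitone
    (I := fun n => Ideal.span {a (u n)}) (L := fun n => leftAnnihilator {(u n).1})
    (antitone_nat_of_succ_le fun n => leftAnnihilator_singleton_le_iff.2 fun r hr =>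
      (hsum (u n) r (hu n ▸ hr)).1)
    (fun n => (Ideal.span_singleton_le_iff_mem _).2 (mem_leftAnnihilator_singleton.2 (hac _)))
    (fun n => by
      refine Submodule.disjoint_def.2 fun y hy hy' => ?_
      obtain ⟨r, rfl⟩ := Ideal.mem_span_singleton'.1 hy
      rw [mem_leftAnnihilator_singleton, hu] at hy'
      exact ha _ r (hsum (u n) _ hy').2)
  exact ha0 _ (Ideal.span_singleton_eq_bot.1 hn)

/-- For `s` regular, the left ideal of all `t` with `t r ∈ R s` is essential. -/
theorem hasClassicalLeftQuotientRing : HasClassicalLeftQuotientRing R := by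
  intro r s hs
  have hE : IsEssentialLeftIdeal (Submodule.comap (LinearMap.toSpanSingleton R R r)
      (Ideal.span {s})) := fun y hy =>
    (hR.isEssentialLeftIdeal_span_singleton hs.2).exists_mul_mul_mem r hy
  obtain ⟨t, ht, htreg⟩ := hR.exists_mem_nonZeroDivisors hsp hE
  obtain ⟨q, hq⟩ := Ideal.mem_span_singleton'.1 (show t * r ∈ Ideal.span {s} from ht)
  exact ⟨t, htreg, q, hq.symm⟩

/-- A left ideal `J` of the classical left quotient ring `Q` has a complement, generated by a
left ideal `K` of `R` that is maximal among those with `K ∩ J = 0`: the essential left ideal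
`(J ∩ R) + K` contains a regular element. -/
theorem isSemisimpleRing {Q : Type*} [Ring Q] {f : R →+* Q}
    (hf : IsLeftLocalization (nonZeroDivisors R) f) : IsSemisimpleRing Q where
  exists_isCompl J := by
    let J' : Ideal R := Ideal.comap f J
    obtain ⟨K, -, hK⟩ := zorn_le_nonempty₀ {K : Ideal R | Disjoint J' K}
      (fun c hc hch K hK => ⟨sSup c, hch.directedOn.disjoint_sSup_right.2 hc,
        fun L hL => le_sSup hL⟩) ⊥ disjoint_bot_right
    have hess : IsEssentialLeftIdeal (J' ⊔ K) := by
      intro x hx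
      by_contra! h
      have hdisj : Disjoint (J' ⊔ K) (Ideal.span {x}) := by
        refine Submodule.disjoint_def.2 fun y hy hy' => ?_
        obtain ⟨r, rfl⟩ := Ideal.mem_span_singleton'.1 hy'
        exact h r hy
      have hxK : x ∈ K := hK.2 (hK.1.disjoint_sup_right_of_disjoint_sup_left hdisj) le_sup_left
        (Ideal.mem_sup_right (Ideal.mem_span_singleton_self x))
      exact hx (by simpa using h 1 (by rw [one_mul]; exact Ideal.mem_sup_right hxK))
    obtain ⟨c, hc, hreg⟩ := hR.exists_mem_nonZeroDivisors hsp hess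
    have hJ : J'.map f = J := by
      refine le_antisymm Ideal.map_comap_le fun q hq => ?_
      obtain ⟨s, hs, r, h⟩ := hf.exists_mul_eq q
      obtain ⟨u, hu⟩ := hf.isUnit s hs
      have hr : f r ∈ J'.map f := Ideal.mem_map_of_mem f
        (show f r ∈ J from h ▸ Ideal.mul_mem_left J _ hq)
      rw [← h, ← hu] at hr
      simpa using (J'.map f).mul_mem_left (↑u⁻¹ : Q) hr
    refine ⟨K.map f, hJ ▸ hf.disjoint_map le_rfl hK.1, codisjoint_iff.2 ?_⟩
    refine Ideal.eq_top_of_isUnit_mem _ (?_ : f c ∈ _) (hf.isUnit c hreg)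
    rw [← hJ, ← Ideal.map_sup]
    exact Ideal.mem_map_of_mem f hc

end IsLeftGoldieRing

end Goldie

end LeftQuot

theorem theorem1p3 (R : Type*) [Ring R] :
    [ IsSemisimpleRing (LeftQuot.StrongLeftQuotientRing R),
      LeftQuot.IsSemiprimeRing (R ⧸ LeftQuot.strongRadical R) ∧
        LeftQuot.IsLeftGoldieRing (R ⧸ LeftQuot.strongRadical R),
      IsSemisimpleRing (LeftQuot.LargestLeftQuotientRing (R ⧸ LeftQuot.strongRadical R)),
      ∃ h : LeftQuot.HasClassicalLeftQuotientRing (R ⧸ LeftQuot.strongRadical R),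
        IsSemisimpleRing
          (LeftQuot.ClassicalLeftQuotientRing (R ⧸ LeftQuot.strongRadical R) h) ].TFAE ∧
    (IsSemisimpleRing (LeftQuot.StrongLeftQuotientRing R) →
      (∃ e : LeftQuot.StrongLeftQuotientRing R ≃+*
            LeftQuot.LargestLeftQuotientRing (R ⧸ LeftQuot.strongRadical R),
          ∀ r : R, e (LeftQuot.toStrong R r) =
            LeftQuot.toLargest (R ⧸ LeftQuot.strongRadical R)
              (Ideal.Quotient.mk (LeftQuot.strongRadical R) r)) ∧
      (∃ (h : LeftQuot.HasClassicalLeftQuotientRing (R ⧸ LeftQuot.strongRadical R))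
          (e : LeftQuot.LargestLeftQuotientRing (R ⧸ LeftQuot.strongRadical R) ≃+*
            LeftQuot.ClassicalLeftQuotientRing (R ⧸ LeftQuot.strongRadical R) h),
          ∀ x : R ⧸ LeftQuot.strongRadical R,
            e (LeftQuot.toLargest (R ⧸ LeftQuot.strongRadical R) x) =
              LeftQuot.toClassical (R ⧸ LeftQuot.strongRadical R) h x) ∧
      LeftQuot.strongDenSet R =
        (nonZeroDivisors (R ⧸ LeftQuot.strongRadical R)).comap
          (Ideal.Quotient.mk (LeftQuot.strongRadical R)) ∧
      LeftQuot.strongDenSet (R ⧸ LeftQuot.strongRadical R) =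
        nonZeroDivisors (R ⧸ LeftQuot.strongRadical R)) := by
  obtain ⟨e, he⟩ := (LeftQuot.isLeftLocalization_toLargest_comp_mk R).exists_ringEquiv
  set A := R ⧸ LeftQuot.strongRadical R
  have hcl : ∀ h : LeftQuot.HasClassicalLeftQuotientRing A,
      ∃ e : LeftQuot.LargestLeftQuotientRing A ≃+* LeftQuot.ClassicalLeftQuotientRing A h,
        ∀ x : A, e (LeftQuot.toLargest A x) = LeftQuot.toClassical A h x := by
    intro h
    refine LeftQuot.IsLeftLocalization.exists_ringEquiv ?_
    rw [LeftQuot.regularDenSet_eq_nonZeroDivisors h]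
    exact LeftQuot.isLeftLocalization_toClassical h
  have goldie : IsSemisimpleRing (LeftQuot.LargestLeftQuotientRing A) →
      LeftQuot.IsSemiprimeRing A ∧ LeftQuot.IsLeftGoldieRing A := fun _ =>
    ⟨LeftQuot.isSemiprimeRing_of_isLeftLocalization (LeftQuot.isLeftLocalization_toLargest A)
        (LeftQuot.regularDenSet_le_nonZeroDivisors A),
      LeftQuot.isLeftGoldieRing_of_isLeftLocalization (LeftQuot.isLeftLocalization_toLargest A)
        (LeftQuot.regularDenSet_le_nonZeroDivisors A)⟩
  refine ⟨?_, fun hss => ?_⟩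
  · tfae_have 1 ↔ 3 := e.isSemisimpleRing_iff
    tfae_have 3 → 2 := goldie
    tfae_have 2 → 4 := fun ⟨hsp, hG⟩ => ⟨hG.hasClassicalLeftQuotientRing hsp,
      hG.isSemisimpleRing hsp (LeftQuot.isLeftLocalization_toClassical _)⟩
    tfae_have 4 → 3 := fun ⟨h, hss⟩ => (hcl h).choose.isSemisimpleRing_iff.2 hss
    tfae_finish
  · obtain ⟨hsp, hG⟩ := goldie e.isSemisimpleRing
    have h := hG.hasClassicalLeftQuotientRing hsp
    have hreg := LeftQuot.regularDenSet_eq_nonZeroDivisors h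
    exact ⟨⟨e, he⟩, ⟨h, hcl h⟩, hreg ▸ LeftQuot.strongDenSet_eq_comap_regularDenSet R,
      hreg ▸ LeftQuot.strongDenSet_quotient_eq_regularDenSet R⟩
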